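/- For a finite simple graph $G$, a drawing of $G$ in the plane represents the vertices by distinct points of $\mathbb{R}^2$ and each edge by a simple arc joining the points of its two ends and passing through no other vertex. The crossing number $\mathrm{cr}(G)$ is the minimum, over all drawings of $G$ in the plane, of the number of pairwise intersections of edges, that is, of pairs $(\{e,f\},p)$ where $e \neq f$ are edges and $p$ is a common point of their arcs that is not a vertex. The $n$-dimensional folded hypercube $FQ_n$ is the graph whose vertices are the binary strings of length $n$, two distinct strings being adjacent if they differ in exactly one bit or if they are bitwise complements of each other. Theorem. For every integer $n \ge 3$, $$\mathrm{cr}(FQ_n) \le \frac{11}{32}\,4^n - (n^2+3n)\,2^{n-3}.$$ -/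

import Mathlib

/-- The `n`-dimensional hypercube: binary strings of length `n`, adjacent when they differ in
exactly one bit. -/
def hypercube (n : ℕ) : SimpleGraph (Fin n → Bool) where
  Adj x y := hammingDist x y = 1
  symm := ⟨fun x y h => by rw [hammingDist_comm]; exact h⟩
  loopless := ⟨fun x h => by simp at h⟩

/-- The `n`-dimensional folded hypercube: the hypercube together with all complementary edges,
which join each string `x` to its bitwise complement. -/
def foldedHypercube (n : ℕ) : SimpleGraph (Fin n → Bool) :=
  hypercube n ⊔ SimpleGraph.fromRel (fun x y => y = fun i => !(x i))

/-- A drawing of a graph in the plane: vertices are distinct points, every edge is a simple arc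
(the image of a continuous injective map of `[0,1]`) joining the points of its two ends, and an
edge passes through no vertex other than its ends. -/
structure PlaneDrawing {V : Type*} (G : SimpleGraph V) where
  /-- the point that represents a vertex -/
  vert : V → ℝ × ℝ
  /-- the closed arc that represents an edge -/
  arc : G.edgeSet → Set (ℝ × ℝ)
  vert_injective : Function.Injective vert
  isArc : ∀ e : G.edgeSet, ∃ γ : unitInterval → ℝ × ℝ, Continuous γ ∧ Function.Injective γ ∧
    Set.range γ = arc e ∧ s(γ 0, γ 1) = Sym2.map vert (e : Sym2 V)
  vert_mem_arc : ∀ (e : G.edgeSet) (v : V), vert v ∈ arc e → v ∈ (e : Sym2 V)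

/-- The pairwise intersections of edges in a drawing: an unordered pair of distinct edges together
with a common point of their arcs that is not a vertex. A point common to `k` edges is thus counted
once for each of the `k.choose 2` pairs, and a pair of edges once for each common point. -/
def PlaneDrawing.crossings {V : Type*} {G : SimpleGraph V} (D : PlaneDrawing G) :
    Set (Sym2 G.edgeSet × (ℝ × ℝ)) :=
  {c | ¬ c.1.IsDiag ∧ (∀ e ∈ c.1, c.2 ∈ D.arc e) ∧ c.2 ∉ Set.range D.vert}

/-- The crossing number: the minimum number of pairwise intersections of edges in a drawing
(`⊤` if no drawing has finitely many). -/
noncomputable def crossingNumber {V : Type*} (G : SimpleGraph V) : ℕ∞ :=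
  ⨅ D : PlaneDrawing G, D.crossings.encard

/-!
A drawing whose vertices lie on a line and whose edges are drawn as arcs in the two half-planes has
as crossings the pairs of edges of a half-plane whose ends alternate on the line. Such a drawing of
`FQ_n` yields one of `FQ_(n+1)`: replace every vertex by two consecutive adjacent copies and every
edge by its two lifts. A crossing of `FQ_n` then gives four crossings, and a pair of edges that
share an end and a half-plane gives one. If the edges at every vertex are split evenly between the
half-planes, there are as few such pairs as possible, and drawing the edge between the copies in
the half-plane with fewer edges keeps the split even. If the two copies of a vertex are ordered by
the parity of its number of ones, the lifts of an edge cross each other only if the edge is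
complementary and `n` is odd. The bound is tight for `FQ_3`, and doubling a drawing of it
loses too much, so the recursion starts from an explicit drawing of `FQ_4`.
-/

/-- The sign of the ordinates in a half-plane. -/
def pageSign (β : Bool) : ℝ := if β then 1 else -1

/-- The parabolic arc over or under the interval `[a, b]` of the first axis, which represents an
edge on page `β` whose ends lie at `a` and `b`. -/
def parabolicArc (β : Bool) (a b : ℝ) : Set (ℝ × ℝ) :=
  (fun x => (x, pageSign β * ((x - a) * (b - x)))) '' Set.Icc a b

section ParabolicArc

variable {β β' : Bool} {a b c d x : ℝ} {p q : ℝ × ℝ}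

lemma pageSign_ne_zero (β : Bool) : pageSign β ≠ 0 := by
  cases β <;> norm_num [pageSign]

lemma exists_simple_arc_image_graph {f : ℝ → ℝ} (hf : Continuous f) (hab : a < b) :
    ∃ γ : unitInterval → ℝ × ℝ, Continuous γ ∧ Function.Injective γ ∧
      Set.range γ = (fun x => (x, f x)) '' Set.Icc a b ∧ γ 0 = (a, f a) ∧ γ 1 = (b, f b) := by
  have hinj : Function.Injective fun x => (x, f x) := fun x y h => congrArg Prod.fst h
  refine ⟨fun t => ((iccHomeoI a b hab).symm t, f ((iccHomeoI a b hab).symm t)), by fun_prop,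
    hinj.comp (Subtype.val_injective.comp (iccHomeoI a b hab).symm.injective), ?_, ?_, ?_⟩
  · rw [Set.image_eq_range]
    exact (iccHomeoI a b hab).symm.surjective.range_comp fun x : Set.Icc a b => ((x : ℝ), f x)
  · simp only [iccHomeoI_symm_apply_coe, Set.Icc.coe_zero, mul_zero, zero_add]
  · simp only [iccHomeoI_symm_apply_coe, Set.Icc.coe_one, mul_one, sub_add_cancel]

lemma eq_or_eq_of_mem_parabolicArc (h : p ∈ parabolicArc β a b) (hp : p.2 = 0) :
    p.1 = a ∨ p.1 = b := by
  obtain ⟨x, -, rfl⟩ := h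
  simpa [pageSign_ne_zero, sub_eq_zero, eq_comm (a := b)] using hp

lemma mem_Ioo_of_mem_parabolicArc (h : p ∈ parabolicArc β a b) (hp : p.2 ≠ 0) :
    p.1 ∈ Set.Ioo a b := by
  obtain ⟨x, hx, rfl⟩ := h
  simp only [ne_eq, mul_eq_zero, sub_eq_zero, not_or] at hp
  exact ⟨lt_of_le_of_ne hx.1 (Ne.symm hp.2.1), lt_of_le_of_ne hx.2 (Ne.symm hp.2.2)⟩

lemma snd_eq_of_mem_parabolicArc (h : p ∈ parabolicArc β a b) :
    p.2 = pageSign β * ((p.1 - a) * (b - p.1)) := by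
  obtain ⟨x, -, rfl⟩ := h
  rfl

lemma page_eq_of_mem_parabolicArc (h : p ∈ parabolicArc β a b) (h' : p ∈ parabolicArc β' c d)
    (hp : p.2 ≠ 0) : β = β' := by
  obtain ⟨ha, hb⟩ := mem_Ioo_of_mem_parabolicArc h hp
  obtain ⟨hc, hd⟩ := mem_Ioo_of_mem_parabolicArc h' hp
  have hab := mul_pos (sub_pos.2 ha) (sub_pos.2 hb)
  have hcd := mul_pos (sub_pos.2 hc) (sub_pos.2 hd)
  have heq := (snd_eq_of_mem_parabolicArc h).symm.trans (snd_eq_of_mem_parabolicArc h')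
  cases β <;> cases β' <;> simp only [pageSign, Bool.false_eq_true, if_true, if_false] at heq ⊢ <;>
    linarith

lemma right_lt_of_left_lt_of_mul_eq_mul (hac : a < c) (hcx : c < x) (hxd : x < d)
    (h : (x - a) * (b - x) = (x - c) * (d - x)) : b < d := by
  by_contra! hdb
  have : (x - c) * (d - x) < (x - a) * (b - x) :=
    mul_lt_mul (by linarith) (by linarith) (by linarith) (by linarith)
  exact this.ne' h

lemma interleaved_of_mem_parabolicArc (h : p ∈ parabolicArc β a b) (h' : p ∈ parabolicArc β c d)
    (hp : p.2 ≠ 0) (hne : ¬(a = c ∧ b = d)) :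
    (a < c ∧ c < b ∧ b < d) ∨ (c < a ∧ a < d ∧ d < b) := by
  obtain ⟨ha, hb⟩ := mem_Ioo_of_mem_parabolicArc h hp
  obtain ⟨hc, hd⟩ := mem_Ioo_of_mem_parabolicArc h' hp
  have heq := mul_left_cancel₀ (pageSign_ne_zero β)
    ((snd_eq_of_mem_parabolicArc h).symm.trans (snd_eq_of_mem_parabolicArc h'))
  rcases lt_trichotomy a c with hac | rfl | hca
  · exact .inl ⟨hac, hc.trans hb, right_lt_of_left_lt_of_mul_eq_mul hac hc hd heq⟩
  · have := mul_left_cancel₀ (sub_pos.2 ha).ne' heq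
    exact absurd ⟨rfl, by linarith⟩ hne
  · exact .inr ⟨hca, ha.trans hd, right_lt_of_left_lt_of_mul_eq_mul hca ha hb heq.symm⟩

lemma eq_of_mem_parabolicArc (hp : p ∈ parabolicArc β a b) (hp' : p ∈ parabolicArc β c d)
    (hq : q ∈ parabolicArc β a b) (hq' : q ∈ parabolicArc β c d) (hac : a < c) (hbd : b < d) :
    p = q := by
  have hpx := mul_left_cancel₀ (pageSign_ne_zero β)
    ((snd_eq_of_mem_parabolicArc hp).symm.trans (snd_eq_of_mem_parabolicArc hp'))
  have hqx := mul_left_cancel₀ (pageSign_ne_zero β)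
    ((snd_eq_of_mem_parabolicArc hq).symm.trans (snd_eq_of_mem_parabolicArc hq'))
  -- The difference of the two quadratic polynomials is linear in the abscissa.
  have hlin : (c + d - a - b) * (p.1 - q.1) = 0 := by linear_combination hqx - hpx
  have hfst : p.1 = q.1 :=
    sub_eq_zero.1 ((mul_eq_zero.1 hlin).resolve_left (by linarith))
  exact Prod.ext hfst (by
    rw [snd_eq_of_mem_parabolicArc hp, snd_eq_of_mem_parabolicArc hq, hfst])

end ParabolicArc

/-- A two-page book drawing: the vertices lie on a line, the spine, and every edge is assigned to
one of the two half-planes bounded by it. The page of a pair that is not an edge is irrelevant. -/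
structure BookDrawing {V : Type*} (G : SimpleGraph V) where
  /-- the position of a vertex on the spine -/
  pos : V → ℕ
  /-- the half-plane that contains an edge -/
  page : Sym2 V → Bool
  pos_injective : Function.Injective pos

namespace BookDrawing

variable {V : Type*} {G : SimpleGraph V}

/-- Two edges, given by their ends in spine order, cross if they lie on the same page and their
ends alternate along the spine, the first edge being the one that starts first. -/
def Crosses (D : BookDrawing G) (e f : V × V) : Prop :=
  D.pos e.1 < D.pos f.1 ∧ D.pos f.1 < D.pos e.2 ∧ D.pos e.2 < D.pos f.2 ∧
    D.page s(e.1, e.2) = D.page s(f.1, f.2)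

instance (D : BookDrawing G) (e f : V × V) : Decidable (D.Crosses e f) :=
  inferInstanceAs (Decidable (_ ∧ _ ∧ _ ∧ _))

/-- The edges, each given once as the pair of its ends in spine order. -/
def orientedEdges [Fintype V] [DecidableRel G.Adj] (D : BookDrawing G) : Finset (V × V) :=
  {e | G.Adj e.1 e.2 ∧ D.pos e.1 < D.pos e.2}

/-- The crossing pairs of edges, each listed once. -/
def crossingPairs [Fintype V] [DecidableRel G.Adj] (D : BookDrawing G) :
    Finset ((V × V) × (V × V)) :=
  {c ∈ D.orientedEdges ×ˢ D.orientedEdges | D.Crosses c.1 c.2}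

lemma mem_orientedEdges [Fintype V] [DecidableRel G.Adj] {D : BookDrawing G} {e : V × V} :
    e ∈ D.orientedEdges ↔ G.Adj e.1 e.2 ∧ D.pos e.1 < D.pos e.2 := by
  simp only [orientedEdges, Finset.mem_filter_univ]

lemma mem_crossingPairs [Fintype V] [DecidableRel G.Adj] {D : BookDrawing G}
    {c : (V × V) × (V × V)} :
    c ∈ D.crossingPairs ↔
      (c.1 ∈ D.orientedEdges ∧ c.2 ∈ D.orientedEdges) ∧ D.Crosses c.1 c.2 := by
  simp only [crossingPairs, Finset.mem_filter, Finset.mem_product]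

section PlaneDrawing

/-- The arc that represents a pair of vertices when the pages are the two half-planes bounded by
the first axis. -/
def edgeArc (D : BookDrawing G) (e : Sym2 V) : Set (ℝ × ℝ) :=
  parabolicArc (D.page e) (e.map D.pos).inf (e.map D.pos).sup

lemma edgeArc_mk (D : BookDrawing G) {a b : V} (h : D.pos a < D.pos b) :
    D.edgeArc s(a, b) = parabolicArc (D.page s(a, b)) (D.pos a) (D.pos b) := by
  simp only [edgeArc, Sym2.map_mk, Sym2.inf_mk, Sym2.sup_mk, inf_of_le_left h.le,
    sup_of_le_right h.le]

lemma exists_ordered_ends (D : BookDrawing G) (e : G.edgeSet) :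
    ∃ a b, (e : Sym2 V) = s(a, b) ∧ G.Adj a b ∧ D.pos a < D.pos b := by
  obtain ⟨⟨a, b⟩, hab : G.Adj a b⟩ := e
  rcases (D.pos_injective.ne hab.ne).lt_or_gt with h | h
  · exact ⟨a, b, rfl, hab, h⟩
  · exact ⟨b, a, Sym2.eq_swap, hab.symm, h⟩

lemma exists_vert_eq_of_mem_edgeArc (D : BookDrawing G) (e : G.edgeSet) {p : ℝ × ℝ}
    (hp : p ∈ D.edgeArc e) (h : p.2 = 0) : ∃ v ∈ (e : Sym2 V), p = ((D.pos v : ℝ), (0 : ℝ)) := by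
  obtain ⟨a, b, he, -, hlt⟩ := D.exists_ordered_ends e
  rw [he, D.edgeArc_mk hlt] at hp
  rw [he]
  rcases eq_or_eq_of_mem_parabolicArc hp h with ha | hb
  · exact ⟨a, Sym2.mem_mk_left a b, Prod.ext ha h⟩
  · exact ⟨b, Sym2.mem_mk_right a b, Prod.ext hb h⟩

/-- The plane drawing with the vertices on the first axis and the edges as parabolic arcs. -/
def toPlaneDrawing (D : BookDrawing G) : PlaneDrawing G where
  vert v := (D.pos v, 0)
  arc e := D.edgeArc e
  vert_injective u v h := D.pos_injective (Nat.cast_injective (congrArg Prod.fst h))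
  isArc e := by
    obtain ⟨a, b, he, -, hlt⟩ := D.exists_ordered_ends e
    obtain ⟨γ, hγ, hinj, hrange, h0, h1⟩ := exists_simple_arc_image_graph
      (f := fun x => pageSign (D.page s(a, b)) * ((x - D.pos a) * (D.pos b - x)))
      (by fun_prop) (Nat.cast_lt.2 hlt)
    refine ⟨γ, hγ, hinj, ?_, ?_⟩
    · rw [hrange, he, D.edgeArc_mk hlt, parabolicArc]
    · simp only [h0, h1, he, Sym2.map_mk, sub_self, zero_mul, mul_zero]
  vert_mem_arc e v h := by
    obtain ⟨w, hw, hvw⟩ := D.exists_vert_eq_of_mem_edgeArc e h rfl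
    rwa [D.pos_injective (Nat.cast_injective (congrArg Prod.fst hvw))]

variable [Fintype V] [DecidableRel G.Adj]

lemma exists_mem_crossingPairs_of_mem_edgeArc (D : BookDrawing G) {e f : G.edgeSet} (hef : e ≠ f)
    {p : ℝ × ℝ} (hpe : p ∈ D.edgeArc e) (hpf : p ∈ D.edgeArc f) (hp : p.2 ≠ 0) :
    ∃ q ∈ D.crossingPairs, s(s(q.1.1, q.1.2), s(q.2.1, q.2.2)) = s((e : Sym2 V), (f : Sym2 V)) := by
  obtain ⟨a, b, he, hab, hlt⟩ := D.exists_ordered_ends e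
  obtain ⟨c, d, hf, hcd, hlt'⟩ := D.exists_ordered_ends f
  rw [he, D.edgeArc_mk hlt] at hpe
  rw [hf, D.edgeArc_mk hlt'] at hpf
  have hpage := page_eq_of_mem_parabolicArc hpe hpf hp
  have hends : ¬((D.pos a : ℝ) = D.pos c ∧ (D.pos b : ℝ) = D.pos d) := by
    simp only [Nat.cast_inj, D.pos_injective.eq_iff]
    rintro ⟨rfl, rfl⟩
    exact hef (Subtype.ext (he.trans hf.symm))
  rw [← hpage] at hpf
  rw [he, hf]
  have h := interleaved_of_mem_parabolicArc hpe hpf hp hends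
  simp only [Nat.cast_lt] at h
  rcases h with ⟨hac, hcb, hbd⟩ | ⟨hca, had, hdb⟩
  · exact ⟨((a, b), (c, d)), mem_crossingPairs.2 ⟨⟨mem_orientedEdges.2 ⟨hab, hlt⟩,
      mem_orientedEdges.2 ⟨hcd, hlt'⟩⟩, hac, hcb, hbd, hpage⟩, rfl⟩
  · exact ⟨((c, d), (a, b)), mem_crossingPairs.2 ⟨⟨mem_orientedEdges.2 ⟨hcd, hlt'⟩,
      mem_orientedEdges.2 ⟨hab, hlt⟩⟩, hca, had, hdb, hpage.symm⟩, Sym2.eq_swap⟩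

lemma exists_mem_crossingPairs_of_mem_crossings (D : BookDrawing G)
    {c : Sym2 G.edgeSet × (ℝ × ℝ)} (hc : c ∈ D.toPlaneDrawing.crossings) :
    ∃ q ∈ D.crossingPairs, s(s(q.1.1, q.1.2), s(q.2.1, q.2.2)) = c.1.map Subtype.val ∧
      c.2 ∈ D.edgeArc s(q.1.1, q.1.2) ∧ c.2 ∈ D.edgeArc s(q.2.1, q.2.2) := by
  obtain ⟨⟨e, f⟩, p⟩ := c
  obtain ⟨hef, hmem, hvert⟩ := hc
  have harc : ∀ e' ∈ s((e : Sym2 V), (f : Sym2 V)), p ∈ D.edgeArc e' := by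
    rintro e' he'
    rcases Sym2.mem_iff.1 he' with rfl | rfl
    · exact hmem e (Sym2.mem_mk_left e f)
    · exact hmem f (Sym2.mem_mk_right e f)
  have hp : p.2 ≠ 0 := fun h => by
    obtain ⟨v, -, hv⟩ :=
      D.exists_vert_eq_of_mem_edgeArc e (harc _ (Sym2.mem_mk_left _ _)) h
    exact hvert ⟨v, hv.symm⟩
  obtain ⟨q, hq, hqef⟩ := D.exists_mem_crossingPairs_of_mem_edgeArc (Sym2.mk_isDiag_iff.not.1 hef)
    (harc _ (Sym2.mem_mk_left _ _)) (harc _ (Sym2.mem_mk_right _ _)) hp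
  rw [← hqef] at harc
  exact ⟨q, hq, hqef, harc _ (Sym2.mem_mk_left _ _), harc _ (Sym2.mem_mk_right _ _)⟩

theorem crossingNumber_le_card_crossingPairs (D : BookDrawing G) :
    crossingNumber G ≤ D.crossingPairs.card := by
  refine (iInf_le _ D.toPlaneDrawing).trans ?_
  choose g hg hends harc harc' using fun c : D.toPlaneDrawing.crossings =>
    D.exists_mem_crossingPairs_of_mem_crossings c.2
  rw [← Set.encard_coe_eq_coe_finsetCard]
  refine Function.Embedding.encard_le ⟨fun c => ⟨g c, hg c⟩, fun c c' h => ?_⟩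
  replace h : g c = g c' := congrArg Subtype.val h
  have hpair : (c : Sym2 G.edgeSet × (ℝ × ℝ)).1 = (c' : Sym2 G.edgeSet × (ℝ × ℝ)).1 :=
    Sym2.map.injective Subtype.val_injective ((hends c).symm.trans (h ▸ hends c'))
  refine Subtype.ext (Prod.ext hpair ?_)
  obtain ⟨-, hac, hcb, hbd, hpage⟩ := mem_crossingPairs.1 (hg c)
  have hx := harc c
  have hy := harc' c
  have hx' := harc c'
  have hy' := harc' c'
  rw [← h] at hx' hy'
  rw [D.edgeArc_mk (hac.trans hcb)] at hx hx'
  rw [D.edgeArc_mk (hcb.trans hbd), ← hpage] at hy hy'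
  exact eq_of_mem_parabolicArc hx hy hx' hy' (Nat.cast_lt.2 hac) (Nat.cast_lt.2 hbd)

end PlaneDrawing

section PageNeighbors

variable [Fintype V] [DecidableRel G.Adj]

/-- The neighbours joined to `v` by an edge on page `β`. -/
def pageNeighbors (D : BookDrawing G) (v : V) (β : Bool) : Finset V :=
  {u | G.Adj v u ∧ D.page s(v, u) = β}

/-- All vertices have degree `d`, and at each of them one page holds `⌊d / 2⌋` edges and the other
`⌈d / 2⌉`. -/
def IsBalanced (D : BookDrawing G) (d : ℕ) : Prop :=
  ∀ v, s((D.pageNeighbors v true).card, (D.pageNeighbors v false).card) = s(d / 2, (d + 1) / 2)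

lemma mem_pageNeighbors {D : BookDrawing G} {v u : V} {β : Bool} :
    u ∈ D.pageNeighbors v β ↔ G.Adj v u ∧ D.page s(v, u) = β := by
  simp only [pageNeighbors, Finset.mem_filter_univ]

end PageNeighbors

section Comap

variable {W : Type*} {H : SimpleGraph W}

/-- The drawing of an isomorphic graph. -/
def comap (D : BookDrawing G) (f : H ≃g G) : BookDrawing H where
  pos := D.pos ∘ f
  page := D.page ∘ Sym2.map f
  pos_injective := D.pos_injective.comp f.injective

variable [Fintype V] [DecidableRel G.Adj] [Fintype W] [DecidableRel H.Adj]

lemma card_crossingPairs_comap (D : BookDrawing G) (f : H ≃g G) :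
    (D.comap f).crossingPairs.card = D.crossingPairs.card :=
  Finset.card_equiv ((f.toEquiv.prodCongr f.toEquiv).prodCongr (f.toEquiv.prodCongr f.toEquiv))
    fun c => by
      simp only [mem_crossingPairs, mem_orientedEdges, Crosses, comap, Equiv.prodCongr_apply,
        Prod.map_fst, Prod.map_snd, RelIso.coe_fn_toEquiv, Function.comp_apply, Sym2.map_mk,
        f.map_adj_iff]

lemma card_pageNeighbors_comap (D : BookDrawing G) (f : H ≃g G) (v : W) (β : Bool) :
    ((D.comap f).pageNeighbors v β).card = (D.pageNeighbors (f v) β).card :=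
  Finset.card_equiv f.toEquiv fun u => by
    simp only [mem_pageNeighbors, comap, RelIso.coe_fn_toEquiv, Function.comp_apply, Sym2.map_mk,
      f.map_adj_iff]

lemma IsBalanced.comap {D : BookDrawing G} {d : ℕ} (hD : D.IsBalanced d) (f : H ≃g G) :
    (D.comap f).IsBalanced d := fun v => by
  rw [card_pageNeighbors_comap, card_pageNeighbors_comap, hD (f v)]

end Comap

section Forks

variable [Fintype V] [DecidableRel G.Adj]

/-- The pairs of edges on the same page that share an end, listed as `⟨(v, β), (p, q)⟩`, where `v`
is the common end, `β` is the page, and the other ends are `p` and `q` in spine order. -/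
def forks (D : BookDrawing G) : Finset (Σ _ : V × Bool, V × V) :=
  Finset.univ.sigma fun t =>
    {e ∈ D.pageNeighbors t.1 t.2 ×ˢ D.pageNeighbors t.1 t.2 | D.pos e.1 < D.pos e.2}

lemma mk_mem_forks {D : BookDrawing G} {v p q : V} (hp : G.Adj v p) (hq : G.Adj v q)
    (hpage : D.page s(v, p) = D.page s(v, q)) (hpq : D.pos p < D.pos q) :
    ⟨(v, D.page s(v, p)), (p, q)⟩ ∈ D.forks := by
  simp only [forks, Finset.mem_sigma, Finset.mem_univ, Finset.mem_filter, Finset.mem_product,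
    mem_pageNeighbors, hp, hq, hpage, hpq, and_self]

lemma card_filter_lt_le_choose_two {α β : Type*} [Preorder β] [DecidableLT β]
    (s : Finset α) (f : α → β) :
    {e ∈ s ×ˢ s | f e.1 < f e.2}.card ≤ s.card.choose 2 := by
  classical
  rw [← Sym2.card_image_offDiag]
  refine Finset.card_le_card_of_injOn (Function.uncurry Sym2.mk) (fun e he => ?_) ?_
  · obtain ⟨hmem, hlt⟩ := Finset.mem_filter.1 he
    obtain ⟨h₁, h₂⟩ := Finset.mem_product.1 hmem
    refine Finset.mem_image_of_mem _ (Finset.mem_offDiag.2 ⟨h₁, h₂, fun h => ?_⟩)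
    exact lt_irrefl _ (h ▸ hlt)
  · rintro ⟨a, b⟩ he ⟨c, d⟩ he' h
    have hab := (Finset.mem_filter.1 he).2
    have hcd := (Finset.mem_filter.1 he').2
    rcases Sym2.eq_iff.1 h with ⟨rfl, rfl⟩ | ⟨rfl, rfl⟩
    · rfl
    · exact absurd hab hcd.asymm

lemma card_forks_le (D : BookDrawing G) :
    D.forks.card ≤ ∑ v, ((D.pageNeighbors v true).card.choose 2 +
      (D.pageNeighbors v false).card.choose 2) := by
  calc D.forks.card
      ≤ ∑ t : V × Bool, (D.pageNeighbors t.1 t.2).card.choose 2 := by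
        rw [forks, Finset.card_sigma]
        exact Finset.sum_le_sum fun t _ => card_filter_lt_le_choose_two _ _
    _ = _ := by simp only [Fintype.sum_prod_type, Fintype.sum_bool]

lemma IsBalanced.card_forks_le {D : BookDrawing G} {d : ℕ} (hD : D.IsBalanced d) :
    D.forks.card ≤ Fintype.card V * ((d / 2).choose 2 + ((d + 1) / 2).choose 2) := by
  refine D.card_forks_le.trans (Finset.sum_le_card_nsmul _ _ _ fun v _ => ?_)
  rcases Sym2.eq_iff.1 (hD v) with ⟨h₁, h₂⟩ | ⟨h₁, h₂⟩
  · rw [h₁, h₂]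
  · rw [h₁, h₂, add_comm]

end Forks

end BookDrawing

section TwistedPrism

variable {V : Type*}

/-- The second end of the lift of the edge from `x.1` to `v` that starts at the copy `x` of its
first end; the lift changes between the two copies when the edge is twisted. -/
def liftEnd (δ : Sym2 V → Bool) (x : V × Bool) (v : V) : V × Bool :=
  (v, xor x.2 (δ s(x.1, v)))

lemma liftEnd_liftEnd (δ : Sym2 V → Bool) (x : V × Bool) (v : V) :
    liftEnd δ (liftEnd δ x v) x.1 = x := by
  simp only [liftEnd, Sym2.eq_swap (a := v), Bool.xor_assoc, Bool.xor_self, Bool.xor_false]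

/-- Each vertex of `G` is split into two adjacent copies, and each edge into two disjoint lifts,
which join equal copies if the edge is untwisted by `δ` and different ones if it is twisted. -/
def twistedPrism (G : SimpleGraph V) (δ : Sym2 V → Bool) : SimpleGraph (V × Bool) where
  Adj x y := (x.1 = y.1 ∧ x.2 ≠ y.2) ∨ (G.Adj x.1 y.1 ∧ y = liftEnd δ x y.1)
  symm := ⟨by
    rintro x y (⟨h₁, h₂⟩ | ⟨hG, hy⟩)
    · exact .inl ⟨h₁.symm, h₂.symm⟩
    · exact .inr ⟨hG.symm, by rw [hy]; exact (liftEnd_liftEnd δ x y.1).symm⟩⟩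
  loopless := ⟨by simp⟩

instance (G : SimpleGraph V) (δ : Sym2 V → Bool) [DecidableEq V] [DecidableRel G.Adj] :
    DecidableRel (twistedPrism G δ).Adj :=
  fun x y => inferInstanceAs (Decidable ((x.1 = y.1 ∧ x.2 ≠ y.2) ∨ (G.Adj x.1 y.1 ∧ _)))

end TwistedPrism

namespace BookDrawing

variable {V : Type*} {G : SimpleGraph V} [DecidableEq V] {D : BookDrawing G}
  {δ : Sym2 V → Bool} {σ q : V → Bool} {x y z w : V × Bool}

/-- The drawing in which each vertex `v` is replaced by two consecutive copies, of which `(v, σ v)`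
comes first and which are joined on page `q v`, while the lifts of an edge stay on its page. -/
def double (D : BookDrawing G) (δ : Sym2 V → Bool) (σ q : V → Bool) :
    BookDrawing (twistedPrism G δ) where
  pos x := 2 * D.pos x.1 + (xor x.2 (σ x.1)).toNat
  page := Sym2.lift ⟨fun x y => if x.1 = y.1 then q x.1 else D.page s(x.1, y.1), fun x y => by
    by_cases h : x.1 = y.1
    · simp only [h, if_true]
    · simp only [h, Ne.symm h, if_false, Sym2.eq_swap]⟩
  pos_injective x y h := by
    have hx := Bool.toNat_le (xor x.2 (σ x.1))
    have hy := Bool.toNat_le (xor y.2 (σ y.1))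
    change 2 * D.pos x.1 + (xor x.2 (σ x.1)).toNat = 2 * D.pos y.1 + (xor y.2 (σ y.1)).toNat at h
    have hfst : x.1 = y.1 := D.pos_injective (by omega)
    rw [hfst, add_right_inj] at h
    exact Prod.ext hfst (Bool.xor_left_inj.1 (Function.LeftInverse.injective Bool.ofNat_toNat h))

lemma double_page_mk :
    (D.double δ σ q).page s(x, y) = if x.1 = y.1 then q x.1 else D.page s(x.1, y.1) := rfl

lemma pos_fst_le_of_double_pos_lt (h : (D.double δ σ q).pos x < (D.double δ σ q).pos y) :
    D.pos x.1 ≤ D.pos y.1 := by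
  have hy := Bool.toNat_le (xor y.2 (σ y.1))
  simp only [double] at h
  omega

lemma pos_fst_lt_of_double_pos_lt (h : (D.double δ σ q).pos x < (D.double δ σ q).pos y)
    (hne : x.1 ≠ y.1) : D.pos x.1 < D.pos y.1 :=
  (pos_fst_le_of_double_pos_lt h).lt_of_ne (D.pos_injective.ne hne)

lemma snd_eq_of_double_pos_lt (h : (D.double δ σ q).pos x < (D.double δ σ q).pos y)
    (heq : x.1 = y.1) : x.2 = σ x.1 ∧ y.2 = !σ x.1 := by
  simp only [double, ← heq, add_lt_add_iff_left] at h
  revert h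
  cases x.2 <;> cases y.2 <;> cases σ x.1 <;> simp

/-- The two copies of a vertex are consecutive, so nothing lies between them. -/
lemma fst_ne_of_double_pos_lt (hxz : (D.double δ σ q).pos x < (D.double δ σ q).pos z)
    (hzy : (D.double δ σ q).pos z < (D.double δ σ q).pos y) : x.1 ≠ y.1 := by
  intro hxy
  have hle := pos_fst_le_of_double_pos_lt hzy
  rw [← hxy] at hle
  have hfst : x.1 = z.1 :=
    D.pos_injective ((pos_fst_le_of_double_pos_lt hxz).antisymm hle)
  have hz := (snd_eq_of_double_pos_lt hxz hfst).2
  have hz' := (snd_eq_of_double_pos_lt hzy (hfst.symm.trans hxy)).1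
  rw [hz, ← hfst] at hz'
  exact Bool.not_ne_self _ hz'

variable [Fintype V] [DecidableRel G.Adj]

lemma lifts_of_mem_crossingPairs_double
    (h : ((x, y), (z, w)) ∈ (D.double δ σ q).crossingPairs) :
    (G.Adj x.1 y.1 ∧ y = liftEnd δ x y.1) ∧ (G.Adj z.1 w.1 ∧ w = liftEnd δ z w.1) ∧
      D.page s(x.1, y.1) = D.page s(z.1, w.1) := by
  obtain ⟨⟨hxy, hzw⟩, hxz, hzy, hyw, hpage⟩ := mem_crossingPairs.1 h
  have hxy' := fst_ne_of_double_pos_lt hxz hzy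
  have hzw' := fst_ne_of_double_pos_lt hzy hyw
  refine ⟨(mem_orientedEdges.1 hxy).1.resolve_left fun h => hxy' h.1,
    (mem_orientedEdges.1 hzw).1.resolve_left fun h => hzw' h.1, ?_⟩
  rwa [double_page_mk, double_page_mk, if_neg hxy', if_neg hzw'] at hpage

/-- The edges whose two lifts cross each other in the doubled drawing. -/
def selfCrossingEdges (D : BookDrawing G) (δ : Sym2 V → Bool) (σ : V → Bool) : Finset (V × V) :=
  {e ∈ D.orientedEdges | xor (σ e.1) (σ e.2) = δ s(e.1, e.2)}

/-- The crossing of the lifts of two crossing edges that start at the given copies. -/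
def crossingOfCrossing (δ : Sym2 V → Bool) (t : ((V × V) × (V × V)) × Bool × Bool) :
    ((V × Bool) × (V × Bool)) × ((V × Bool) × (V × Bool)) :=
  let x := (t.1.1.1, t.2.1)
  let z := (t.1.2.1, t.2.2)
  ((x, liftEnd δ x t.1.1.2), (z, liftEnd δ z t.1.2.2))

/-- The crossing of the two lifts of an edge. -/
def crossingOfEdge (δ : Sym2 V → Bool) (σ : V → Bool) (e : V × V) :
    ((V × Bool) × (V × Bool)) × ((V × Bool) × (V × Bool)) :=
  let x := (e.1, σ e.1)
  let z := (e.1, !σ e.1)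
  ((x, liftEnd δ x e.2), (z, liftEnd δ z e.2))

/-- The only pair of lifts of the edges of a fork that cross. The three cases are those of a common
end that lies before, between and after the other ends. -/
def crossingOfFork (D : BookDrawing G) (δ : Sym2 V → Bool) (σ : V → Bool)
    (t : Σ _ : V × Bool, V × V) : ((V × Bool) × (V × Bool)) × ((V × Bool) × (V × Bool)) :=
  let v := t.1.1
  let p := t.2.1
  let r := t.2.2
  let x := (v, σ v)
  let z := (v, !σ v)
  if D.pos v < D.pos p then ((x, liftEnd δ x p), (z, liftEnd δ z r))
  else if D.pos v < D.pos r then ((liftEnd δ z p, z), (x, liftEnd δ x r))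
  else ((liftEnd δ x p, x), (liftEnd δ z r, z))

lemma crossing_mem_image_crossingOfCrossing
    (h : ((x, y), (z, w)) ∈ (D.double δ σ q).crossingPairs)
    (hxz : x.1 ≠ z.1) (hzy : z.1 ≠ y.1) (hyw : y.1 ≠ w.1) :
    ((x, y), (z, w)) ∈ (D.crossingPairs ×ˢ Finset.univ).image (crossingOfCrossing δ) := by
  obtain ⟨⟨hG, hy⟩, ⟨hG', hw⟩, hpage⟩ := lifts_of_mem_crossingPairs_double h
  obtain ⟨-, hlt₁, hlt₂, hlt₃, -⟩ := mem_crossingPairs.1 h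
  replace hlt₁ := pos_fst_lt_of_double_pos_lt hlt₁ hxz
  replace hlt₂ := pos_fst_lt_of_double_pos_lt hlt₂ hzy
  replace hlt₃ := pos_fst_lt_of_double_pos_lt hlt₃ hyw
  refine Finset.mem_image.2 ⟨(((x.1, y.1), (z.1, w.1)), (x.2, z.2)), Finset.mem_product.2
    ⟨mem_crossingPairs.2 ⟨⟨mem_orientedEdges.2 ⟨hG, hlt₁.trans hlt₂⟩,
      mem_orientedEdges.2 ⟨hG', hlt₂.trans hlt₃⟩⟩, hlt₁, hlt₂, hlt₃, hpage⟩,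
      Finset.mem_univ _⟩, ?_⟩
  simp only [crossingOfCrossing, Prod.mk.eta, ← hy, ← hw]

lemma crossing_mem_image_crossingOfEdge
    (h : ((x, y), (z, w)) ∈ (D.double δ σ q).crossingPairs) (hxz : x.1 = z.1) (hyw : y.1 = w.1) :
    ((x, y), (z, w)) ∈ (D.selfCrossingEdges δ σ).image (crossingOfEdge δ σ) := by
  obtain ⟨⟨hG, hy⟩, ⟨-, hw⟩, -⟩ := lifts_of_mem_crossingPairs_double h
  obtain ⟨-, hlt₁, hlt₂, hlt₃, -⟩ := mem_crossingPairs.1 h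
  have hx : x = (x.1, σ x.1) := Prod.ext rfl (snd_eq_of_double_pos_lt hlt₁ hxz).1
  have hz : z = (x.1, !σ x.1) := Prod.ext hxz.symm (snd_eq_of_double_pos_lt hlt₁ hxz).2
  have hpos := pos_fst_lt_of_double_pos_lt (hlt₁.trans hlt₂) hG.ne
  have hσ : σ y.1 = xor (σ x.1) (δ s(x.1, y.1)) := by
    rw [← (snd_eq_of_double_pos_lt hlt₃ hyw).1, ← (snd_eq_of_double_pos_lt hlt₁ hxz).1]
    exact congrArg Prod.snd hy
  refine Finset.mem_image.2 ⟨(x.1, y.1), Finset.mem_filter.2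
    ⟨mem_orientedEdges.2 ⟨hG, hpos⟩, ?_⟩, ?_⟩
  · rw [hσ, ← Bool.xor_assoc, Bool.xor_self, Bool.false_xor]
  · simp only [crossingOfEdge]
    rw [← hx, ← hz, ← hy, hyw, ← hw]

lemma crossing_mem_image_crossingOfFork
    (h : ((x, y), (z, w)) ∈ (D.double δ σ q).crossingPairs)
    (hfork : x.1 = z.1 ∧ y.1 ≠ w.1 ∨ z.1 = y.1 ∨ x.1 ≠ z.1 ∧ y.1 = w.1) :
    ((x, y), (z, w)) ∈ D.forks.image (D.crossingOfFork δ σ) := by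
  obtain ⟨⟨hG, hy⟩, ⟨hG', hw⟩, hpage⟩ := lifts_of_mem_crossingPairs_double h
  obtain ⟨-, hlt₁, hlt₂, hlt₃, -⟩ := mem_crossingPairs.1 h
  have hab := pos_fst_lt_of_double_pos_lt (hlt₁.trans hlt₂) hG.ne
  have hcd := pos_fst_lt_of_double_pos_lt (hlt₂.trans hlt₃) hG'.ne
  have hx : x = liftEnd δ y x.1 := by rw [hy]; exact (liftEnd_liftEnd δ x y.1).symm
  have hz : z = liftEnd δ w z.1 := by rw [hw]; exact (liftEnd_liftEnd δ z w.1).symm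
  rw [Finset.mem_image]
  rcases hfork with ⟨hxz, hyw⟩ | hzy | ⟨hxz, hyw⟩
  · have hx' : x = (x.1, σ x.1) := Prod.ext rfl (snd_eq_of_double_pos_lt hlt₁ hxz).1
    have hz' : z = (x.1, !σ x.1) := Prod.ext hxz.symm (snd_eq_of_double_pos_lt hlt₁ hxz).2
    refine ⟨_, mk_mem_forks hG (hxz ▸ hG') (by rw [hpage, hxz])
      (pos_fst_lt_of_double_pos_lt hlt₃ hyw), ?_⟩
    simp only [crossingOfFork, hab, if_true]
    rw [← hx', ← hz', ← hy, ← hw]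
  · have hz' : z = (y.1, σ y.1) := Prod.ext hzy (hzy ▸ (snd_eq_of_double_pos_lt hlt₂ hzy).1)
    have hy' : y = (y.1, !σ y.1) := Prod.ext rfl (hzy ▸ (snd_eq_of_double_pos_lt hlt₂ hzy).2)
    rw [hzy] at hcd
    refine ⟨_, mk_mem_forks hG.symm (hzy ▸ hG') (by rw [Sym2.eq_swap, hpage, hzy])
      (hab.trans hcd), ?_⟩
    simp only [crossingOfFork, hab.asymm, hcd, if_true, if_false]
    rw [← hy', ← hz', ← hx, ← hw]
  · have hy' : y = (y.1, σ y.1) := Prod.ext rfl (snd_eq_of_double_pos_lt hlt₃ hyw).1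
    have hw' : w = (y.1, !σ y.1) := Prod.ext hyw.symm (snd_eq_of_double_pos_lt hlt₃ hyw).2
    rw [← hyw] at hcd
    refine ⟨_, mk_mem_forks hG.symm (hyw ▸ hG'.symm)
      (by rw [Sym2.eq_swap, hpage, hyw, Sym2.eq_swap]) (pos_fst_lt_of_double_pos_lt hlt₁ hxz), ?_⟩
    simp only [crossingOfFork, hab.asymm, hcd.asymm, if_false]
    rw [← hy', ← hw', ← hx, ← hz]

theorem card_crossingPairs_double_le :
    (D.double δ σ q).crossingPairs.card ≤
      4 * D.crossingPairs.card + D.forks.card + (D.selfCrossingEdges δ σ).card := by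
  have hcover : (D.double δ σ q).crossingPairs ⊆
      (D.crossingPairs ×ˢ Finset.univ).image (crossingOfCrossing δ) ∪
        D.forks.image (D.crossingOfFork δ σ) ∪
        (D.selfCrossingEdges δ σ).image (crossingOfEdge δ σ) := by
    rintro ⟨⟨x, y⟩, ⟨z, w⟩⟩ h
    simp only [Finset.mem_union]
    by_cases hself : x.1 = z.1 ∧ y.1 = w.1
    · exact .inr (crossing_mem_image_crossingOfEdge h hself.1 hself.2)
    by_cases hproper : x.1 ≠ z.1 ∧ z.1 ≠ y.1 ∧ y.1 ≠ w.1
    · exact .inl (.inl (crossing_mem_image_crossingOfCrossing h hproper.1 hproper.2.1 hproper.2.2))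
    · exact .inl (.inr (crossing_mem_image_crossingOfFork h (by tauto)))
  refine (Finset.card_le_card hcover).trans <| (Finset.card_union_le _ _).trans <|
    add_le_add ((Finset.card_union_le _ _).trans <| add_le_add ?_ Finset.card_image_le)
      Finset.card_image_le
  calc ((D.crossingPairs ×ˢ Finset.univ).image (crossingOfCrossing δ)).card
      ≤ (D.crossingPairs ×ˢ (Finset.univ : Finset (Bool × Bool))).card := Finset.card_image_le
    _ = 4 * D.crossingPairs.card := by
      rw [Finset.card_product, Finset.card_univ, Fintype.card_prod, Fintype.card_bool, mul_comm]

lemma card_pageNeighbors_double (D : BookDrawing G) (δ : Sym2 V → Bool) (σ q : V → Bool)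
    (x : V × Bool) (β : Bool) :
    ((D.double δ σ q).pageNeighbors x β).card =
      (D.pageNeighbors x.1 β).card + if q x.1 = β then 1 else 0 := by
  have hsplit : (D.double δ σ q).pageNeighbors x β = (D.pageNeighbors x.1 β).image (liftEnd δ x) ∪
      if q x.1 = β then {(x.1, !x.2)} else ∅ := by
    ext y
    simp only [mem_pageNeighbors, Finset.mem_union, Finset.mem_image]
    constructor
    · rintro ⟨⟨h₁, h₂⟩ | ⟨hG, hy⟩, hpage⟩
      · rw [double_page_mk, if_pos h₁] at hpage
        rw [if_pos hpage, Finset.mem_singleton]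
        exact .inr (Prod.ext h₁.symm (Bool.eq_not.2 h₂.symm))
      · rw [double_page_mk, if_neg hG.ne] at hpage
        exact .inl ⟨y.1, ⟨hG, hpage⟩, hy.symm⟩
    · rintro (⟨p, ⟨hG, hpage⟩, rfl⟩ | hy)
      · exact ⟨.inr ⟨hG, rfl⟩, (if_neg hG.ne).trans hpage⟩
      · split_ifs at hy with hq
        · rw [Finset.mem_singleton.1 hy]
          exact ⟨.inl ⟨rfl, (Bool.not_ne_self _).symm⟩, (if_pos rfl).trans hq⟩
        · exact absurd hy (Finset.notMem_empty y)
  rw [hsplit, Finset.card_union_of_disjoint, Finset.card_image_of_injective]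
  · split_ifs <;> simp only [Finset.card_singleton, Finset.card_empty]
  · exact fun p p' h => congrArg Prod.fst h
  · refine Finset.disjoint_left.2 fun y hy hy' => ?_
    obtain ⟨p, hp, rfl⟩ := Finset.mem_image.1 hy
    split_ifs at hy' with hq
    · exact (mem_pageNeighbors.1 hp).1.ne' (congrArg Prod.fst (Finset.mem_singleton.1 hy'))
    · exact Finset.notMem_empty _ hy'

/-- The page that holds fewer edges at `v`. -/
def lighterPage (D : BookDrawing G) (v : V) : Bool :=
  decide ((D.pageNeighbors v true).card ≤ (D.pageNeighbors v false).card)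

lemma IsBalanced.double {d : ℕ} (hD : D.IsBalanced d) (δ : Sym2 V → Bool) (σ : V → Bool) :
    (D.double δ σ D.lighterPage).IsBalanced (d + 1) := by
  intro x
  have h := hD x.1
  rw [card_pageNeighbors_double, card_pageNeighbors_double]
  simp only [lighterPage, Sym2.eq_iff, decide_eq_true_eq, decide_eq_false_iff_not] at h ⊢
  split_ifs <;> omega

end BookDrawing

section FoldedHypercube

variable {n : ℕ}

instance : DecidableRel (hypercube n).Adj :=
  fun x y => inferInstanceAs (Decidable (hammingDist x y = 1))

instance : DecidableRel (foldedHypercube n).Adj :=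
  inferInstanceAs (DecidableRel (hypercube n ⊔ SimpleGraph.fromRel fun x y => y = xᶜ).Adj)

lemma hammingDist_compl (x : Fin n → Bool) : hammingDist x xᶜ = n := by
  simp [hammingDist]

lemma ne_compl (hn : n ≠ 0) (x : Fin n → Bool) : x ≠ xᶜ := fun h =>
  hn ((hammingDist_compl x).symm.trans (hammingDist_eq_zero.2 h))

lemma foldedHypercube_adj_iff (hn : n ≠ 0) {x y : Fin n → Bool} :
    (foldedHypercube n).Adj x y ↔ hammingDist x y = 1 ∨ y = xᶜ := by
  refine or_congr_right ((SimpleGraph.fromRel_adj _ _ _).trans ?_)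
  change x ≠ y ∧ (y = xᶜ ∨ x = yᶜ) ↔ y = xᶜ
  rw [eq_compl_comm (x := x), or_self, and_iff_right_iff_imp]
  rintro rfl
  exact ne_compl hn x

lemma hammingDist_cons (a b : Bool) (u v : Fin n → Bool) :
    hammingDist (Fin.cons a u : Fin (n + 1) → Bool) (Fin.cons b v) =
      (if a = b then 0 else 1) + hammingDist u v := by
  simp only [hammingDist, Finset.card_filter, Fin.sum_univ_succ, Fin.cons_zero, Fin.cons_succ,
    ne_eq, ite_not]

lemma cons_eq_compl_cons_iff {a b : Bool} {u v : Fin n → Bool} :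
    (Fin.cons b v : Fin (n + 1) → Bool) = (Fin.cons a u)ᶜ ↔ b = !a ∧ v = uᶜ := by
  simp [funext_iff, Fin.forall_fin_succ]

/-- The twist under which the prism over a folded hypercube is the next folded hypercube: only the
complementary edges, which are the pairs invariant under complementation, are twisted. -/
def antipodalTwist (n : ℕ) (e : Sym2 (Fin n → Bool)) : Bool :=
  decide (e.map compl = e)

lemma antipodalTwist_mk (hn : n ≠ 0) (u v : Fin n → Bool) :
    antipodalTwist n s(u, v) = decide (v = uᶜ) := by
  simp only [antipodalTwist, Sym2.map_mk, Sym2.eq_iff, (ne_compl hn _).symm, false_or,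
    eq_comm (b := v), compl_eq_comm (x := v), and_self]

lemma foldedHypercube_cons_adj_cons_iff (hn : 2 ≤ n) (a b : Bool) (u v : Fin n → Bool) :
    (foldedHypercube (n + 1)).Adj (Fin.cons a u) (Fin.cons b v) ↔
      (twistedPrism (foldedHypercube n) (antipodalTwist n)).Adj (u, a) (v, b) := by
  change _ ↔ u = v ∧ a ≠ b ∨ (foldedHypercube n).Adj u v ∧
    (v, b) = (v, xor a (antipodalTwist n s(u, v)))
  rw [foldedHypercube_adj_iff n.succ_ne_zero, foldedHypercube_adj_iff (by omega), hammingDist_cons,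
    cons_eq_compl_cons_iff, antipodalTwist_mk (by omega), Prod.mk_right_inj]
  by_cases hv : v = uᶜ
  · have hdist : hammingDist u v = n := hv ▸ hammingDist_compl u
    have hne : u ≠ v := hv ▸ ne_compl (by omega) u
    simp only [hdist, ← hv, hne]
    cases a <;> cases b <;> simp <;> omega
  · have h0 := hammingDist_eq_zero (x := u) (y := v)
    simp only [hv]
    cases a <;> cases b <;> simp [h0]

/-- The folded hypercube as a twisted prism, the first bit of a string being its copy. -/
def twistedPrismFoldedHypercubeIso (hn : 2 ≤ n) :
    twistedPrism (foldedHypercube n) (antipodalTwist n) ≃g foldedHypercube (n + 1) where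
  toEquiv := (Equiv.prodComm _ _).trans (Fin.consEquiv fun _ => Bool)
  map_rel_iff' := foldedHypercube_cons_adj_cons_iff hn _ _ _ _

/-- The parity of the number of ones. Ordering the copies of a vertex by it keeps the two lifts
of a hypercube edge from crossing. -/
def bitParity (x : Fin n → Bool) : Bool := (∑ i, (x i).toNat).bodd

lemma sum_toNat_add_sum_toNat (x y : Fin n → Bool) :
    ∑ i, (x i).toNat + ∑ i, (y i).toNat = hammingDist x y + 2 * ∑ i, (x i && y i).toNat := by
  simp only [hammingDist, Finset.card_filter, Finset.mul_sum, ← Finset.sum_add_distrib]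
  refine Finset.sum_congr rfl fun i _ => ?_
  cases x i <;> cases y i <;> rfl

lemma xor_bitParity (x y : Fin n → Bool) :
    xor (bitParity x) (bitParity y) = (hammingDist x y).bodd := by
  rw [bitParity, bitParity, ← Nat.bodd_add, sum_toNat_add_sum_toNat, Nat.bodd_add, Nat.bodd_mul,
    Nat.bodd_two, Bool.false_and, Bool.xor_false]

end FoldedHypercube

lemma two_mul_card_filter_lt_le {α β : Type*} [Fintype α] [Preorder β] [DecidableLT β]
    {f : α → α} (hf : Function.Involutive f) (g : α → β) :
    2 * ({a | g a < g (f a)} : Finset α).card ≤ Fintype.card α := by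
  classical
  set s : Finset α := {a | g a < g (f a)} with hs
  have hdisj : Disjoint s (s.image f) := by
    simp only [Finset.disjoint_left, Finset.mem_image, hs, Finset.mem_filter_univ]
    rintro _ ha ⟨b, hb, rfl⟩
    rw [hf b] at ha
    exact ha.asymm hb
  calc 2 * s.card = (s ∪ s.image f).card := by
        rw [Finset.card_union_of_disjoint hdisj, Finset.card_image_of_injective s hf.injective,
          two_mul]
    _ ≤ Fintype.card α := Finset.card_le_univ _

lemma four_mul_choose_two_add_choose_two_le {n : ℕ} (hn : 4 ≤ n) :
    4 * (((n + 1) / 2).choose 2 + ((n + 2) / 2).choose 2) + 2 * (n % 2) + 4 ≤ n ^ 2 + n := by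
  have hchoose (k : ℕ) : (k + 1) * k = (k + 1).choose 2 * 2 := by
    simpa only [Nat.choose_one_right] using Nat.add_one_mul_choose_eq k 1
  obtain ⟨k, rfl | rfl⟩ := n.even_or_odd'
  · have hpascal : (k + 1).choose 2 = k + k.choose 2 := by
      rw [Nat.choose_succ_succ', Nat.choose_one_right]
    rw [show (2 * k + 1) / 2 = k by omega, show (2 * k + 2) / 2 = k + 1 by omega,
      show 2 * k % 2 = 0 by omega]
    nlinarith [hchoose k]
  · have hk : 2 ≤ k := by omega
    rw [show (2 * k + 1 + 1) / 2 = k + 1 by omega, show (2 * k + 1 + 2) / 2 = k + 1 by omega,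
      show (2 * k + 1) % 2 = 1 by omega]
    nlinarith [hchoose k]

namespace BookDrawing

lemma mem_selfCrossingEdges_bitParity {n : ℕ} (hn : n ≠ 0) {D : BookDrawing (foldedHypercube n)}
    {u v : Fin n → Bool} (h : (u, v) ∈ D.selfCrossingEdges (antipodalTwist n) bitParity) :
    n.bodd = true ∧ v = uᶜ ∧ D.pos u < D.pos uᶜ := by
  obtain ⟨he, hδ⟩ := Finset.mem_filter.1 h
  obtain ⟨hadj, hlt⟩ := mem_orientedEdges.1 he
  rw [xor_bitParity, antipodalTwist_mk hn] at hδ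
  have hv : v = uᶜ := ((foldedHypercube_adj_iff hn).1 hadj).elim
    (fun hdist => of_decide_eq_true (hδ.symm.trans (congrArg Nat.bodd hdist))) id
  simp only [hv, hammingDist_compl, decide_true] at hδ hlt
  exact ⟨hδ, hv, hlt⟩

lemma two_mul_card_selfCrossingEdges_bitParity_le {n : ℕ} (hn : n ≠ 0)
    (D : BookDrawing (foldedHypercube n)) :
    2 * (D.selfCrossingEdges (antipodalTwist n) bitParity).card ≤ n % 2 * 2 ^ n := by
  rcases hodd : n.bodd with _ | _
  · have hempty : D.selfCrossingEdges (antipodalTwist n) bitParity = ∅ :=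
      Finset.eq_empty_of_forall_notMem fun e he => by
        simp [(mem_selfCrossingEdges_bitParity hn he).1] at hodd
    rw [hempty, Finset.card_empty]
    exact Nat.zero_le _
  · have hinj : (D.selfCrossingEdges (antipodalTwist n) bitParity).card ≤
        ({u | D.pos u < D.pos uᶜ} : Finset (Fin n → Bool)).card := by
      refine Finset.card_le_card_of_injOn Prod.fst (fun e he => ?_) fun e he e' he' h => ?_
      · exact (Finset.mem_filter_univ _).2 (mem_selfCrossingEdges_bitParity hn he).2.2
      · refine Prod.ext h ?_
        rw [(mem_selfCrossingEdges_bitParity hn he).2.1,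
          (mem_selfCrossingEdges_bitParity hn he').2.1, h]
    rw [Nat.mod_two_of_bodd, hodd, Bool.toNat_true, one_mul]
    calc _ ≤ _ := Nat.mul_le_mul_left 2 hinj
      _ ≤ _ := two_mul_card_filter_lt_le compl_involutive D.pos
      _ = _ := by rw [Fintype.card_fun, Fintype.card_bool, Fintype.card_fin]

/-- The drawing whose edges on the page `true`, the upper half-plane, are those whose ends have the
listed positions. -/
def ofUpperArcs {V : Type*} {G : SimpleGraph V} (pos : V → ℕ) (hpos : Function.Injective pos)
    (arcs : List (Sym2 ℕ)) : BookDrawing G where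
  pos := pos
  page e := decide (e.map pos ∈ arcs)
  pos_injective := hpos

/-- An optimal two-page drawing of the folded hypercube of dimension 3, which is `K₄,₄`. The first
list is the spine order, where a string is coded by the number with these binary digits, the least
significant one first. -/
def foldedHypercubeThree : BookDrawing (foldedHypercube 3) :=
  ofUpperArcs (fun v => [5, 2, 6, 4, 3, 7, 0, 1].idxOf (Nat.ofBits v))
    (by unfold Function.Injective; decide +kernel)
    [s(0, 1), s(0, 3), s(1, 2), s(2, 7), s(3, 6), s(4, 5), s(4, 7), s(5, 6)]

/-- A balanced two-page drawing of the folded hypercube of dimension 4, given like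
`foldedHypercubeThree`. -/
def foldedHypercubeFour : BookDrawing (foldedHypercube 4) :=
  ofUpperArcs
    (fun v => [0, 2, 8, 10, 13, 15, 5, 7, 6, 4, 14, 12, 11, 9, 3, 1].idxOf (Nat.ofBits v))
    (by unfold Function.Injective; decide +kernel)
    [s(0, 1), s(0, 2), s(1, 14), s(2, 11), s(2, 13), s(3, 10), s(3, 12), s(4, 11), s(4, 13),
      s(5, 7), s(5, 10), s(5, 12), s(6, 7), s(6, 9), s(8, 9), s(8, 10), s(13, 15), s(14, 15)]

lemma card_crossingPairs_foldedHypercubeThree :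
    foldedHypercubeThree.crossingPairs.card = 4 := by
  decide +kernel

lemma card_crossingPairs_foldedHypercubeFour :
    foldedHypercubeFour.crossingPairs.card = 32 := by
  decide +kernel

lemma isBalanced_foldedHypercubeFour : foldedHypercubeFour.IsBalanced 5 := by
  unfold IsBalanced
  decide +kernel

theorem exists_isBalanced_foldedHypercube_succ {n : ℕ} (hn : 4 ≤ n)
    {D : BookDrawing (foldedHypercube n)} (hD : D.IsBalanced (n + 1)) :
    ∃ D' : BookDrawing (foldedHypercube (n + 1)), D'.IsBalanced (n + 2) ∧
      4 * D'.crossingPairs.card + 4 * 2 ^ n ≤ 16 * D.crossingPairs.card + (n ^ 2 + n) * 2 ^ n := by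
  let f := (twistedPrismFoldedHypercubeIso (show 2 ≤ n by omega)).symm
  refine ⟨_, (hD.double (antipodalTwist n) bitParity).comap f, ?_⟩
  rw [card_crossingPairs_comap]
  have hdouble := card_crossingPairs_double_le (D := D) (δ := antipodalTwist n) (σ := bitParity)
    (q := D.lighterPage)
  have hforks := hD.card_forks_le
  rw [Fintype.card_fun, Fintype.card_bool, Fintype.card_fin] at hforks
  have hself := two_mul_card_selfCrossingEdges_bitParity_le (by omega) D
  have hchoose := Nat.mul_le_mul_right (2 ^ n) (four_mul_choose_two_add_choose_two_le hn)
  linarith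

theorem exists_isBalanced_foldedHypercube {n : ℕ} (hn : 4 ≤ n) :
    ∃ D : BookDrawing (foldedHypercube n), D.IsBalanced (n + 1) ∧
      32 * D.crossingPairs.card + 4 * (n ^ 2 + 3 * n) * 2 ^ n ≤ 11 * 4 ^ n := by
  induction n, hn using Nat.le_induction with
  | base =>
    refine ⟨foldedHypercubeFour, isBalanced_foldedHypercubeFour, ?_⟩
    rw [card_crossingPairs_foldedHypercubeFour]
    norm_num
  | succ n hn ih =>
    obtain ⟨D, hD, hcard⟩ := ih
    obtain ⟨D', hD', hcard'⟩ := exists_isBalanced_foldedHypercube_succ hn hD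
    refine ⟨D', hD', ?_⟩
    rw [pow_succ 4, pow_succ 2]
    linarith

theorem exists_card_crossingPairs_foldedHypercube_le {n : ℕ} (hn : 3 ≤ n) :
    ∃ D : BookDrawing (foldedHypercube n),
      32 * D.crossingPairs.card + 4 * (n ^ 2 + 3 * n) * 2 ^ n ≤ 11 * 4 ^ n := by
  rcases hn.eq_or_lt with rfl | hn
  · refine ⟨foldedHypercubeThree, ?_⟩
    rw [card_crossingPairs_foldedHypercubeThree]
    norm_num
  · obtain ⟨D, -, hD⟩ := exists_isBalanced_foldedHypercube hn
    exact ⟨D, hD⟩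

end BookDrawing

theorem theorem2p1 (n : ℕ) (hn : 3 ≤ n) :
    ∃ k : ℕ, crossingNumber (foldedHypercube n) = (k : ℕ∞) ∧
      (k : ℝ) ≤ 11 / 32 * 4 ^ n - ((n : ℝ) ^ 2 + 3 * (n : ℝ)) * 2 ^ (n - 3) := by
  obtain ⟨D, hD⟩ := BookDrawing.exists_card_crossingPairs_foldedHypercube_le hn
  obtain ⟨k, hk, hkD⟩ := ENat.le_natCast_iff.1 D.crossingNumber_le_card_crossingPairs
  refine ⟨k, hk, ?_⟩
  have hbound : (32 : ℝ) * k + 4 * (n ^ 2 + 3 * n) * 2 ^ n ≤ 11 * 4 ^ n := by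
    exact_mod_cast (by omega : 32 * k + 4 * (n ^ 2 + 3 * n) * 2 ^ n ≤ 11 * 4 ^ n)
  have hpow : (2 : ℝ) ^ n = 2 ^ (n - 3) * 2 ^ 3 := (pow_sub_mul_pow 2 hn).symm
  rw [hpow] at hbound
  linarith
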